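/- Let $K$ be a field of characteristic zero, let $L$ be a finite extension of $K$, and let $\{a_n\}_{n\ge 0}$ be a rational sequence in $L$, i.e. a sequence of elements of $L$ whose generating function $\sum_{n\ge 0} a_n x^n \in L[[x]]$ is (the expansion at $0$ of) a rational function in $L(x)$. Then: (1) The sequence of degrees $\deg(a_n) = [K(a_n):K]$ is virtually periodic: there are integers $N \ge 0$ and $r \ge 1$ such that $[K(a_{n+r}):K] = [K(a_n):K]$ for all $n > N$. (2) Let $P_n(T) \in K[T]$ be the minimal polynomial of $a_n$ over $K$. Then $\{P_n(T)\}_{n\ge 0}$ is a rational sequence: its generating function $\sum_{n\ge 0} P_n(T) x^n$ is a rational function in $x$ with coefficients in the field $K(T)$, and all its (finite) poles, which lie in an algebraic closure of $K(T)$, are algebraic over $K$. -/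

import Mathlib

open scoped IntermediateField PowerSeries LaurentSeries

/-- The sequence `a` is virtually periodic: from some index on it is periodic, with a
positive period. -/
def IsVirtuallyPeriodic {α : Type*} (a : ℕ → α) : Prop :=
  ∃ N r : ℕ, 0 < r ∧ ∀ n : ℕ, N < n → a (n + r) = a n

/-- The rational function `R` over the field `F` is the generating function `∑ aₙ xⁿ` of the
sequence `a`: its Laurent expansion at `0` is the power series with coefficients `a`. -/
def IsGenFun {F : Type*} [Field F] (a : ℕ → F) (R : RatFunc F) : Prop :=
  (R : F⸨X⸩) = ((PowerSeries.mk a : F⟦X⟧) : F⸨X⸩)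

/-- The sequence `a` in the field `F` is rational: its generating function is a rational
function. -/
def IsRationalSeq {F : Type*} [Field F] (a : ℕ → F) : Prop :=
  ∃ R : RatFunc F, IsGenFun a R

/-- The element `z` of the extension `E` of `F` is a (finite) pole of the rational function `R`:
it is a root of the denominator of `R` in lowest terms. -/
def IsPole {F E : Type*} [Field F] [Field E] [Algebra F E] (R : RatFunc F) (z : E) : Prop :=
  Polynomial.aeval z R.denom = 0

/-- The minimal polynomial of `b` over `K`, as an element of the rational function field `K(T)`. -/
noncomputable def minpolyT (K : Type*) {L : Type*} [Field K] [Field L] [Algebra K L] (b : L) :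
    RatFunc K :=
  algebraMap (Polynomial K) (RatFunc K) (minpoly K b)

/-! Rational sequences are exactly the linear recurrences, and a recurrence over `L` yields one over
`K` because `L` is algebraic over `K`. For embeddings `σ`, `τ` of `L` into an algebraic closure, `σ
aₙ - τ aₙ` is thus a recurrence over `K`, so its zero set is virtually periodic by
Skolem–Mahler–Lech (`isVirtuallyPeriodic_zeros`). Hence the pattern of coincidences among the
conjugates of `aₙ` is virtually periodic. The degree is the number of classes of this pattern. For a
fixed pattern the minimal polynomial is a product of factors `X - σ aₙ` over fixed representatives;
so `Pₙ` is a finite sum of virtually periodic indicators times products of recurrences. Such sums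
and products are again recurrences over `K` (`IsLinRec.add`, `IsLinRec.mul`), and constant
coefficients in `K` force the poles to be algebraic over `K`.

Skolem–Mahler–Lech is proved `p`-adically over `ℤ` (`eq_zero_of_infinite_zeros`,
`zeroDichotomy_int`). A transcendence basis, clearing of denominators and specialization at integer
points reduce the general case to `ℤ`. -/

open Polynomial

/-! ### Polynomials acting on sequences through the shift -/

section Shift

variable {A V : Type*} [CommRing A] [AddCommGroup V] [Module A V]

/-- The left shift of sequences in `V`. -/
def shift (A V : Type*) [CommRing A] [AddCommGroup V] [Module A V] : Module.End A (ℕ → V) :=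
  LinearMap.funLeft A V Nat.succ

@[simp]
theorem shift_apply (b : ℕ → V) (n : ℕ) : shift A V b n = b (n + 1) := rfl

@[simp]
theorem shift_pow_apply (k : ℕ) (b : ℕ → V) (n : ℕ) : (shift A V ^ k) b n = b (n + k) := by
  induction k generalizing n with
  | zero => simp
  | succ k ih => rw [pow_succ', Module.End.mul_apply, shift_apply, ih]; congr 1; omega

/-- The action of a polynomial on sequences, the variable acting as the left shift. -/
noncomputable def act (q : A[X]) : Module.End A (ℕ → V) := aeval (shift A V) q

theorem act_apply (q : A[X]) (b : ℕ → V) (n : ℕ) :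
    act q b n = q.sum fun i c => c • b (n + i) := by
  simp [act, aeval_eq_sum_range, Polynomial.sum_over_range]

theorem act_monomial (i : ℕ) (c : A) (b : ℕ → V) (n : ℕ) :
    act (C c * X ^ i) b n = c • b (n + i) := by
  simp [act]

theorem act_add (p q : A[X]) (b : ℕ → V) : act (p + q) b = act p b + act q b := by
  simp [act]

theorem act_mul (p q : A[X]) (b : ℕ → V) : act (p * q) b = act p (act q b) := by
  simp [act]

theorem act_X_pow (k : ℕ) (b : ℕ → V) (n : ℕ) : act (X ^ k : A[X]) b n = b (n + k) := by
  simp [act]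

theorem act_eq_zero_of_dvd {p q : A[X]} (h : p ∣ q) {b : ℕ → V} (hb : act p b = 0) :
    act q b = 0 := by
  obtain ⟨g, rfl⟩ := h
  rw [mul_comm, act_mul, hb, map_zero]

theorem act_map_comp {B W : Type*} [CommRing B] [AddCommGroup W] [Module B W] {φ : A →+* B}
    (f : V →ₛₗ[φ] W) (q : A[X]) (b : ℕ → V) : act (q.map φ) (f ∘ b) = f ∘ act q b := by
  induction q using Polynomial.induction_on' with
  | add p q hp hq =>
    rw [Polynomial.map_add, act_add, act_add, hp, hq]
    ext n; simp
  | monomial i c =>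
    ext n
    rw [Polynomial.map_monomial, ← C_mul_X_pow_eq_monomial, ← C_mul_X_pow_eq_monomial,
      act_monomial, Function.comp_apply, Function.comp_apply, act_monomial, map_smulₛₗ]

theorem act_map_algebraMap {B : Type*} [CommRing B] [Algebra A B] [Module B V]
    [IsScalarTower A B V] (q : A[X]) (b : ℕ → V) : act (q.map (algebraMap A B)) b = act q b :=
  act_map_comp (φ := algebraMap A B)
    ({ toFun := id, map_add' := fun _ _ => rfl, map_smul' := by simp } : V →ₛₗ[algebraMap A B] V)
    q b

theorem act_comp {W : Type*} [AddCommGroup W] [Module A W] (f : V →ₗ[A] W) (q : A[X])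
    (b : ℕ → V) : act q (f ∘ b) = f ∘ act q b := by
  simpa using act_map_comp f q b

theorem comp_act_eq_zero {W : Type*} [AddCommGroup W] [Module A W] (f : V →ₗ[A] W) {q : A[X]}
    {b : ℕ → V} (hb : act q b = 0) : act q (f ∘ b) = 0 := by
  rw [act_comp, hb]; ext; simp

/-- A linear recurrence over `B` implies one over any subring over which `B` is algebraic. -/
theorem exists_act_eq_zero_of_isAlgebraic {B : Type*} [CommRing B] [IsDomain B] [IsDomain A]
    [Algebra A B] [Algebra.IsAlgebraic A B] [Module B V] [IsScalarTower A B V] {q : B[X]}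
    (hq : q ≠ 0) {b : ℕ → V} (hb : act q b = 0) : ∃ p : A[X], p ≠ 0 ∧ act p b = 0 := by
  obtain ⟨p, hp, hdvd⟩ := Polynomial.exists_dvd_map_of_isAlgebraic (R := A) hq
  exact ⟨p, hp, by rw [← act_map_algebraMap (B := B)]; exact act_eq_zero_of_dvd hdvd hb⟩

end Shift

/-! ### Rational generating functions and linear recurrences -/

section GeneratingFunction

variable {F : Type*} [Field F]

theorem coeff_reflect_mul_mk (a : ℕ → F) (N m : ℕ) (q : F[X]) (hq : q.natDegree ≤ N) :
    PowerSeries.coeff (m + N) ((reflect N q : F⟦X⟧) * PowerSeries.mk a) = act q a m := by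
  refine Polynomial.induction_with_natDegree_le
    (fun q => PowerSeries.coeff (m + N) ((reflect N q : F⟦X⟧) * PowerSeries.mk a) = act q a m)
    N ?_ ?_ ?_ q hq
  · simp [act]
  · intro i c _ hi
    rw [act_monomial, reflect_C_mul_X_pow, revAt_le hi]
    rw [Polynomial.coe_mul, Polynomial.coe_C, Polynomial.coe_pow, Polynomial.coe_X, mul_assoc,
      PowerSeries.coeff_C_mul, show m + N = (m + i) + (N - i) by omega,
      PowerSeries.coeff_X_pow_mul, PowerSeries.coeff_mk, smul_eq_mul]
  · intro f g _ _ hf hg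
    rw [reflect_add, Polynomial.coe_add, add_mul, map_add, hf, hg, act_add, Pi.add_apply]

theorem isGenFun_div_iff (a : ℕ → F) (P : F[X]) {Q : F[X]} (hQ : Q ≠ 0) :
    IsGenFun a (algebraMap F[X] (RatFunc F) P / algebraMap F[X] (RatFunc F) Q) ↔
      (Q : F⟦X⟧) * PowerSeries.mk a = (P : F⟦X⟧) := by
  have hQ' : ((Q : F⟦X⟧) : F⸨X⸩) ≠ 0 := by
    rw [Ne, map_eq_zero_iff _ HahnSeries.ofPowerSeries_injective, Polynomial.coe_eq_zero_iff]
    exact hQ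
  have hcoe : ∀ P : F[X], ((algebraMap F[X] (RatFunc F) P : RatFunc F) : F⸨X⸩) =
      ((P : F⟦X⟧) : F⸨X⸩) := fun P => (RatFunc.coe_coe P).symm
  rw [IsGenFun, map_div₀, hcoe, hcoe, div_eq_iff hQ',
    ← PowerSeries.coe_mul, (HahnSeries.ofPowerSeries_injective (Γ := ℤ) (R := F)).eq_iff, mul_comm,
    eq_comm]

theorem IsRationalSeq.exists_act_eq_zero {a : ℕ → F} (ha : IsRationalSeq a) :
    ∃ q : F[X], q ≠ 0 ∧ act q a = 0 := by
  obtain ⟨R, hR⟩ := ha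
  rw [← RatFunc.num_div_denom R, isGenFun_div_iff _ _ R.denom_ne_zero] at hR
  -- The power of `X` skips the initial terms, where the numerator may have nonzero coefficients.
  refine ⟨X ^ (R.num.natDegree + 1) * reflect R.denom.natDegree R.denom, ?_, ?_⟩
  · simp [reflect_eq_zero_iff, R.denom_ne_zero]
  · ext n
    rw [act_mul, act_X_pow, ← coeff_reflect_mul_mk a R.denom.natDegree, reflect_reflect, hR]
    · simp only [Polynomial.coeff_coe, Pi.zero_apply]
      exact coeff_eq_zero_of_natDegree_lt (by omega)
    · exact natDegree_reflect_le.trans (by simp)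

/-- A sequence satisfying a linear recurrence is rational, and the denominator is the reverse of
the characteristic polynomial. -/
theorem exists_isGenFun_of_act_eq_zero {a : ℕ → F} {q : F[X]} (hq : q ≠ 0) (ha : act q a = 0) :
    ∃ R : RatFunc F, IsGenFun a R ∧ R.denom ∣ q.reverse := by
  have hr : q.reverse ≠ 0 := by simpa using hq
  refine ⟨algebraMap F[X] (RatFunc F)
    (PowerSeries.trunc q.natDegree ((q.reverse : F⟦X⟧) * PowerSeries.mk a)) /
      algebraMap F[X] (RatFunc F) q.reverse, ?_, RatFunc.denom_div_dvd _ _⟩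
  rw [isGenFun_div_iff _ _ hr]
  ext n
  rw [Polynomial.coeff_coe, PowerSeries.coeff_trunc]
  split_ifs with h
  · rfl
  · obtain ⟨m, rfl⟩ := Nat.exists_eq_add_of_le' (not_lt.mp h)
    rw [Polynomial.reverse, coeff_reflect_mul_mk _ _ _ _ le_rfl, ha, Pi.zero_apply]

end GeneratingFunction

/-! ### A `p`-adic vanishing criterion -/

section Padic

variable {p : ℕ} [hp : Fact p.Prime]

/-- Legendre's formula bounds `(p - 1) * v(k!)` by `k`, and `p - 1 ≥ 2`. -/
theorem two_mul_padicValNat_factorial_le (h3 : 3 ≤ p) (k : ℕ) :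
    2 * padicValNat p k.factorial ≤ k := by
  have h := sub_one_mul_padicValNat_factorial (p := p) k
  calc 2 * padicValNat p k.factorial ≤ (p - 1) * padicValNat p k.factorial :=
        Nat.mul_le_mul_right _ (by omega)
    _ ≤ k := by omega

/-- For odd `p` the `p`-adic number `p ^ k / k!` is integral and divisible by `p ^ s`
whenever `2 * s ≤ k`. -/
theorem exists_mul_factorial_eq_pow (h3 : 3 ≤ p) (k : ℕ) :
    ∃ e : ℤ_[p], e * (k.factorial : ℤ_[p]) = (p : ℤ_[p]) ^ k ∧
      ∀ s, 2 * s ≤ k → (p : ℤ_[p]) ^ s ∣ e := by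
  have hk : (k.factorial : ℤ_[p]) ≠ 0 := by exact_mod_cast k.factorial_ne_zero
  have hv := PadicInt.unitCoeff_spec hk
  have hval : (k.factorial : ℤ_[p]).valuation = padicValNat p k.factorial := by
    exact_mod_cast (PadicInt.valuation_coe (k.factorial : ℤ_[p])).symm.trans
      (Padic.valuation_natCast _)
  rw [hval] at hv
  set u := PadicInt.unitCoeff hk
  set v := padicValNat p k.factorial
  have h2 : 2 * v ≤ k := two_mul_padicValNat_factorial_le h3 k
  refine ⟨(p : ℤ_[p]) ^ (k - v) * (u⁻¹ : ℤ_[p]ˣ), ?_, fun s hs => ?_⟩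
  · rw [hv, show (p : ℤ_[p]) ^ (k - v) * ↑u⁻¹ * (↑u * (p : ℤ_[p]) ^ v) =
      (p : ℤ_[p]) ^ (k - v) * (p : ℤ_[p]) ^ v * (↑u⁻¹ * ↑u) by ring, ← pow_add, Units.inv_mul,
      mul_one, Nat.sub_add_cancel (by omega)]
  · exact Dvd.dvd.mul_right (pow_dvd_pow _ (by omega)) _

/-- If all coefficients of `H` are divisible by `c` and `G₀` has degree less than the number of
points of `t`, then the values of `G₀ + H` are divisible by `c` once `G₀ + H` vanishes on `t`. -/
theorem dvd_eval_of_eval_eq_zero {R : Type*} [CommRing R] [IsDomain R] {c : R} {G₀ H : R[X]}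
    {t : Finset R} (hdeg : G₀.degree < t.card) (ht : ∀ y ∈ t, (G₀ + C c * H).eval y = 0) (x : R) :
    c ∣ (G₀ + C c * H).eval x := by
  set P : R[X] := ∏ y ∈ t, (X - C y) with hP
  have hmonic : P.Monic := monic_prod_X_sub_C _ _
  have hPd : P.degree = t.card := by
    rw [degree_eq_natDegree hmonic.ne_zero, hP, natDegree_finsetProd_X_sub_C_eq_card]
  have hdvd : P ∣ G₀ + C c * H := by
    rcases eq_or_ne (G₀ + C c * H) 0 with h0 | h0
    · rw [h0]; exact dvd_zero _
    · refine (Multiset.prod_X_sub_C_dvd_iff_le_roots h0 t.val).mpr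
        ((Multiset.le_iff_subset t.nodup).mpr fun y hy => ?_)
      exact (mem_roots h0).mpr (ht y hy)
  -- Modulo the monic `P`, the low-degree `G₀` is its own remainder, so `G₀` is itself a multiple of
  -- `c`.
  have h0 : (G₀ + C c * H) %ₘ P = 0 := (modByMonic_eq_zero_iff_dvd hmonic).mpr hdvd
  rw [add_modByMonic, (modByMonic_eq_self_iff hmonic).mpr (hPd ▸ hdeg), ← smul_eq_C_mul,
    smul_modByMonic, add_eq_zero_iff_eq_neg] at h0
  rw [h0]
  exact ⟨(H - H %ₘ P).eval x, by simp [smul_eq_C_mul]; ring⟩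

/-- A sequence `n ↦ ∑ (n choose k) p ^ k d k` with infinitely many zeros vanishes. -/
theorem eq_zero_of_infinite_zeros (h3 : 3 ≤ p) (f d : ℕ → ℤ)
    (hf : ∀ n, f n = ∑ k ∈ Finset.range (n + 1), (n.choose k : ℤ) * (p : ℤ) ^ k * d k)
    (hinf : {n | f n = 0}.Infinite) (x : ℕ) : f x = 0 := by
  choose e he hes using exists_mul_factorial_eq_pow (p := p) h3
  suffices h : ∀ s : ℕ, (p : ℤ_[p]) ^ s ∣ (f x : ℤ_[p]) by
    have hlt : (f x).natAbs < p ^ (f x).natAbs := Nat.lt_pow_self hp.out.one_lt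
    refine Int.eq_zero_of_abs_lt_dvd ((PadicInt.pow_p_dvd_int_iff _ _).mp (h (f x).natAbs)) ?_
    rw [Int.abs_eq_natAbs]
    exact_mod_cast hlt
  intro s
  classical
  -- From index `2 * s` on, the terms of the sum are divisible by `p ^ s`; the earlier ones form a
  -- polynomial of degree below `2 * s`, so `2 * s` zeros suffice.
  obtain ⟨t, hts, htc⟩ := hinf.exists_subset_card_eq (2 * s)
  obtain ⟨N, hN⟩ : ∃ N, ∀ n ∈ insert x t, n < N :=
    ⟨(insert x t).sup id + 1, fun n hn => Nat.lt_succ_of_le (Finset.le_sup (f := id) hn)⟩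
  -- Since `p ^ k = e k * k!`, the term `(n choose k) p ^ k d k` is a polynomial in `n` with
  -- `p`-adic integer coefficients.
  let g : ℕ → ℤ_[p][X] := fun k => C ((d k : ℤ_[p]) * e k) * descPochhammer ℤ_[p] k
  have hval : ∀ n < N, (f n : ℤ_[p]) = (∑ k ∈ Finset.range N, g k).eval (n : ℤ_[p]) := by
    intro n hn
    rw [hf, eval_finsetSum, Int.cast_sum]
    rw [← Finset.sum_subset (Finset.range_mono (Nat.succ_le_of_lt hn))]
    · refine Finset.sum_congr rfl fun k _ => ?_
      simp only [g, eval_mul, eval_C, descPochhammer_eval_eq_descFactorial,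
        Nat.descFactorial_eq_factorial_mul_choose]
      push_cast
      rw [← he]
      ring
    · intro k _ hk
      have : n < k := by simpa using hk
      simp [g, descPochhammer_eval_eq_descFactorial, Nat.descFactorial_of_lt this]
  have hdvd : ∀ k, 2 * s ≤ k → ∃ h : ℤ_[p][X], g k = C ((p : ℤ_[p]) ^ s) * h := by
    intro k hk
    obtain ⟨w, hw⟩ := hes k s hk
    refine ⟨C ((d k : ℤ_[p]) * w) * descPochhammer ℤ_[p] k, ?_⟩
    simp only [g]
    rw [hw]
    simp only [C_mul]
    ring
  choose! h hh using hdvd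
  have hsplit : ∑ k ∈ Finset.range N, g k =
      ∑ k ∈ Finset.range N with k < 2 * s, g k +
        C ((p : ℤ_[p]) ^ s) * ∑ k ∈ Finset.range N with ¬ k < 2 * s, h k := by
    rw [Finset.mul_sum, ← Finset.sum_filter_add_sum_filter_not _ (fun k => k < 2 * s)]
    congr 1
    refine Finset.sum_congr rfl fun k hk => hh k ?_
    simpa using (Finset.mem_filter.mp hk).2
  rw [hval x (hN x (by simp)), hsplit]
  refine dvd_eval_of_eval_eq_zero (t := t.image (fun n : ℕ => (n : ℤ_[p]))) ?_ ?_ _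
  · rw [Finset.card_image_of_injective _ Nat.cast_injective, htc]
    refine (degree_sum_le _ _).trans_lt ?_
    rw [Finset.sup_lt_iff (by exact WithBot.bot_lt_coe _)]
    intro k hk
    have hk2 : k < 2 * s := (Finset.mem_filter.mp hk).2
    refine (degree_le_of_natDegree_le (n := k) ?_).trans_lt (by exact_mod_cast hk2)
    exact (natDegree_C_mul_le _ _).trans (descPochhammer_natDegree _ _).le
  · intro y hy
    obtain ⟨n, hn, rfl⟩ := Finset.mem_image.mp hy
    rw [← hsplit, ← hval n (hN n (by simp [hn]))]
    have : f n = 0 := hts hn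
    simp [this]

end Padic

/-! ### Zeros along residue classes, over `ℤ` and over polynomial rings -/

section ZeroDichotomy

/-- On every residue class modulo `r` the sequence vanishes identically or has only finitely many
zeros. -/
def ZeroDichotomy {V : Type*} [Zero V] (r : ℕ) (b : ℕ → V) : Prop :=
  ∀ c, {n | b (c + r * n) = 0}.Infinite → ∀ n, b (c + r * n) = 0

/-- This allows the auxiliary specialization or functional to depend on the nonzero term, as long as
the modulus `r` does not. -/
theorem ZeroDichotomy.of_separating.{w, v} {V : Type v} [Zero V] {r : ℕ}
    {b : ℕ → V}
    (h : ∀ n, b n ≠ 0 → ∃ (W : Type w) (_ : Zero W) (b' : ℕ → W), ZeroDichotomy r b' ∧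
      (∀ m, b m = 0 → b' m = 0) ∧ b' n ≠ 0) : ZeroDichotomy r b := by
  intro c hc n
  by_contra hn
  obtain ⟨W, _, b', hb', hz, hne⟩ := h _ hn
  exact hne (hb' c (hc.mono fun m hm => hz _ hm) n)

/-- Two powers of the root coincide in the finite ring `k[X]/(q)`, and `X` can be cancelled because
it is coprime to `q`. -/
theorem exists_dvd_X_pow_sub_one {k : Type*} [Field k] [Finite k] {q : k[X]}
    (hq : q.coeff 0 ≠ 0) : ∃ r : ℕ, 0 < r ∧ q ∣ X ^ r - 1 := by
  have hq0 : q ≠ 0 := by rintro rfl; simp at hq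
  have : Module.Finite k (AdjoinRoot q) := (AdjoinRoot.powerBasis hq0).finite
  have : Finite (AdjoinRoot q) := Module.finite_of_finite k
  obtain ⟨i, j, hij, h⟩ :=
    Finite.exists_ne_map_eq_of_infinite (fun n : ℕ => (AdjoinRoot.root q) ^ n)
  wlog hlt : i < j generalizing i j
  · exact this j i hij.symm h.symm (by omega)
  refine ⟨j - i, by omega, ?_⟩
  have hcop : IsCoprime q (X ^ i) := by
    refine IsCoprime.pow_right (IsCoprime.symm ?_)
    rw [Irreducible.coprime_iff_not_dvd irreducible_X, X_dvd_iff]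
    exact hq
  refine hcop.dvd_of_dvd_mul_left ?_
  rw [← AdjoinRoot.mk_eq_zero, mul_sub, ← pow_add, Nat.add_sub_cancel' hlt.le]
  simp [h]

/-- Modulo `q` one has `X ^ r = 1 + p h`. Expanding `(1 + p h) ^ n` by the binomial theorem puts `b
(c + r * n)` in the form required by `eq_zero_of_infinite_zeros`. -/
theorem zeroDichotomy_int {p : ℕ} [hp : Fact p.Prime] (h3 : 3 ≤ p) {r : ℕ} {q : ℤ[X]}
    (hq : q.map (Int.castRingHom (ZMod p)) ∣ X ^ r - 1) {b : ℕ → ℤ} (hb : act q b = 0) :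
    ZeroDichotomy r b := by
  obtain ⟨g₀, hg₀⟩ := hq
  obtain ⟨g, rfl⟩ := Polynomial.map_surjective _
    (ZMod.ringHom_surjective (Int.castRingHom (ZMod p))) g₀
  have hdvd : C (p : ℤ) ∣ X ^ r - 1 - q * g := by
    rw [C_dvd_iff_dvd_coeff]
    intro i
    rw [← ZMod.intCast_zmod_eq_zero_iff_dvd, ← eq_intCast (Int.castRingHom (ZMod p)), ← coeff_map]
    simp [hg₀]
  obtain ⟨h, hh⟩ := hdvd
  intro c hc
  refine eq_zero_of_infinite_zeros h3 _ (fun k => act (h ^ k) b c) (fun n => ?_) hc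
  have hd : q ∣ (X ^ r) ^ n - (C (p : ℤ) * h + 1) ^ n := by
    refine Dvd.dvd.trans ⟨g, ?_⟩ (sub_dvd_pow_sub_pow _ _ _)
    rw [← hh]; ring
  have h0 := act_eq_zero_of_dvd hd hb
  rw [act, map_sub, LinearMap.sub_apply, sub_eq_zero, ← pow_mul] at h0
  change b (c + r * n) = _
  rw [← act_X_pow (A := ℤ) (r * n) b c, act, h0, add_pow, map_sum, LinearMap.sum_apply, Finset.sum_apply]
  refine Finset.sum_congr rfl fun k _ => ?_
  rw [one_pow, mul_one, mul_pow, ← C_pow, mul_comm, ← mul_assoc, ← C_eq_natCast, ← C_mul, map_mul,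
    Module.End.mul_apply, aeval_C, Module.algebraMap_end_apply, Pi.smul_apply, smul_eq_mul]
  rfl

/-- All integer points congruent to `z₀` modulo `p` give the same reduction of `q`, hence the same
`r`; and no nonzero polynomial vanishes at all of them. -/
theorem exists_zeroDichotomy_mvPolynomial {σ : Type*} {q : (MvPolynomial σ ℤ)[X]}
    (hq : q.coeff 0 ≠ 0) :
    ∃ r : ℕ, 0 < r ∧ ∀ b : ℕ → MvPolynomial σ ℤ, act q b = 0 → ZeroDichotomy r b := by
  obtain ⟨z₀, hz₀⟩ : ∃ z₀ : σ → ℤ, MvPolynomial.eval z₀ (q.coeff 0) ≠ 0 := by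
    by_contra! h
    exact hq (MvPolynomial.funext fun z => by simpa using h z)
  -- A prime this large is odd and does not divide the specialized constant coefficient.
  obtain ⟨p, hple, hp⟩ :=
    Nat.exists_infinite_primes (max 3 ((MvPolynomial.eval z₀ (q.coeff 0)).natAbs + 1))
  have : Fact p.Prime := ⟨hp⟩
  have hcong : ∀ z : σ → ℤ, (∀ i, (p : ℤ) ∣ z i - z₀ i) →
      (Int.castRingHom (ZMod p)).comp (MvPolynomial.eval z) =
        (Int.castRingHom (ZMod p)).comp (MvPolynomial.eval z₀) := by
    intro z hz
    refine MvPolynomial.ringHom_ext (by simp) fun i => ?_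
    have := (ZMod.intCast_zmod_eq_zero_iff_dvd _ p).mpr (hz i)
    rw [Int.cast_sub, sub_eq_zero] at this
    simpa using this
  obtain ⟨r, hr, hdvd⟩ := exists_dvd_X_pow_sub_one (k := ZMod p)
    (q := q.map ((Int.castRingHom (ZMod p)).comp (MvPolynomial.eval z₀))) (by
      rw [coeff_map, RingHom.comp_apply, eq_intCast, Ne, ZMod.intCast_zmod_eq_zero_iff_dvd]
      intro h
      have := Nat.le_of_dvd (Int.natAbs_pos.mpr hz₀) (Int.natCast_dvd.mp h)
      omega)
  refine ⟨r, hr, fun b hb => ZeroDichotomy.of_separating fun n hn => ?_⟩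
  obtain ⟨z, hz, hne⟩ : ∃ z : σ → ℤ, (∀ i, (p : ℤ) ∣ z i - z₀ i) ∧
      MvPolynomial.eval z (b n) ≠ 0 := by
    by_contra! h
    refine hn (MvPolynomial.funext_set (fun i => {t | (p : ℤ) ∣ t - z₀ i}) (fun i => ?_)
      fun z hz => by simpa using h z fun i => hz i trivial)
    refine Set.infinite_of_injective_forall_mem (f := fun t : ℤ => z₀ i + p * t) ?_ ?_
    · intro s t hst
      simpa [hp.ne_zero] using hst
    · intro t; simp
  let f : MvPolynomial σ ℤ →ₛₗ[MvPolynomial.eval z] ℤ :=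
    { toFun := MvPolynomial.eval z, map_add' := map_add _, map_smul' := by simp }
  refine ⟨ℤ, inferInstance, f ∘ b, ?_, fun m hm => by simp [hm], hne⟩
  refine zeroDichotomy_int (p := p) (by omega) (q := q.map (MvPolynomial.eval z)) ?_ ?_
  · rwa [Polynomial.map_map, hcong z hz]
  · rw [act_map_comp, hb]
    ext; simp

end ZeroDichotomy

/-! ### The Skolem–Mahler–Lech theorem -/

section SkolemMahlerLech

/-- Scaling the `n`-th term by the `n`-th power of the leading coefficient makes the recurrence
monic without changing the zeros when that coefficient acts injectively. -/
theorem act_integralNormalization {A V : Type*} [CommRing A] [AddCommGroup V] [Module A V]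
    {q : A[X]} (hq : 1 ≤ q.natDegree) {b : ℕ → V} (hb : act q b = 0) :
    act q.integralNormalization (fun n => q.leadingCoeff ^ n • b n) = 0 := by
  have hsum : ∀ (p : A[X]), p.natDegree ≤ q.natDegree → ∀ (b : ℕ → V) n,
      act p b n = ∑ i ∈ Finset.range (q.natDegree + 1), p.coeff i • b (n + i) := by
    intro p hp b n
    rw [act_apply]
    exact sum_over_range' p (by simp) _ (by omega)
  ext n
  have h := congrFun hb n
  rw [hsum _ le_rfl] at h
  rw [hsum _ (by simp)]
  calc _ = ∑ i ∈ Finset.range (q.natDegree + 1),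
        q.leadingCoeff ^ (n + (q.natDegree - 1)) • q.coeff i • b (n + i) := by
        refine Finset.sum_congr rfl fun i _ => ?_
        rw [smul_smul, smul_smul, pow_add, mul_left_comm,
          integralNormalization_coeff_mul_leadingCoeff_pow i hq, pow_add]
        congr 1; ring
    _ = 0 := by rw [← Finset.smul_sum, h]; simp

/-- A sequence in the fraction field of `A` satisfying a monic recurrence over `A` has a common
denominator. -/
theorem exists_forall_isInteger {A E : Type*} [CommRing A] [IsDomain A] [Field E] [Algebra A E]
    [IsFractionRing A E] {q : A[X]} (hq : q.Monic) {b : ℕ → E} (hb : act q b = 0) :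
    ∃ D : A, D ≠ 0 ∧ ∀ n, IsLocalization.IsInteger A (D • b n) := by
  obtain ⟨D, hD⟩ := IsLocalization.exist_integer_multiples (nonZeroDivisors A)
    (Finset.range q.natDegree) b
  refine ⟨D, nonZeroDivisors.coe_ne_zero D, fun n => ?_⟩
  induction n using Nat.strong_induction_on with
  | _ n ih =>
    by_cases hn : n < q.natDegree
    · exact hD n (Finset.mem_range.mpr hn)
    · obtain ⟨m, rfl⟩ := Nat.exists_eq_add_of_le' (not_lt.mp hn)
      have h := congrFun hb m
      rw [act_apply, sum_over_range q (by simp), Finset.sum_range_succ, hq.coeff_natDegree,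
        one_smul, Pi.zero_apply, add_eq_zero_iff_neg_eq] at h
      rw [← h, smul_neg, Finset.smul_sum, ← Finset.sum_neg_distrib]
      refine Subsemiring.sum_mem (algebraMap A E).rangeS fun i hi => ?_
      rw [smul_comm, ← neg_smul]
      exact IsLocalization.isInteger_smul (ih _ (by have := Finset.mem_range.mp hi; omega))

theorem exists_zeroDichotomy_of_isFractionRing {σ E V : Type*} [Field E]
    [Algebra (MvPolynomial σ ℤ) E] [IsFractionRing (MvPolynomial σ ℤ) E] [AddCommGroup V]
    [Module E V] [Module (MvPolynomial σ ℤ) V] [IsScalarTower (MvPolynomial σ ℤ) E V]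
    {q : (MvPolynomial σ ℤ)[X]} (hq : q.coeff 0 ≠ 0) {b : ℕ → V} (hb : act q b = 0) :
    ∃ r : ℕ, 0 < r ∧ ZeroDichotomy r b := by
  set A := MvPolynomial σ ℤ
  have hinj : Function.Injective (algebraMap A E) := IsFractionRing.injective A E
  -- The extra factor guarantees positive degree and preserves the constant coefficient.
  set q' : A[X] := q * (X + C 1)
  have hq0 : q ≠ 0 := by rintro rfl; simp at hq
  have hdeg : 1 ≤ q'.natDegree := by
    rw [natDegree_mul hq0 (X_add_C_ne_zero 1), natDegree_X_add_C]; omega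
  have hne : q' ≠ 0 := by rintro h; simp [h] at hdeg
  have hlc : q'.leadingCoeff ≠ 0 := leadingCoeff_ne_zero.mpr hne
  have hb' : act q' b = 0 := act_eq_zero_of_dvd ⟨_, rfl⟩ hb
  have hc0 : q'.integralNormalization.coeff 0 ≠ 0 := by
    have h := integralNormalization_coeff_mul_leadingCoeff_pow 0 hdeg
    rw [pow_zero, mul_one] at h
    rw [h]
    refine mul_ne_zero ?_ (pow_ne_zero _ hlc)
    simpa [q', mul_coeff_zero] using hq
  obtain ⟨r, hr, hdich⟩ := exists_zeroDichotomy_mvPolynomial hc0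
  refine ⟨r, hr, ZeroDichotomy.of_separating fun n hn => ?_⟩
  obtain ⟨ℓ, hℓ⟩ : ∃ ℓ : Module.Dual E V, ℓ (b n) ≠ 0 := by
    by_contra! h
    exact hn ((Module.forall_dual_apply_eq_zero_iff E (b n)).mp h)
  have hb1 : act q'.integralNormalization (fun n => q'.leadingCoeff ^ n • ℓ (b n)) = 0 := by
    convert comp_act_eq_zero (ℓ.restrictScalars A) (act_integralNormalization hdeg hb') using 2
    ext m; simp
  obtain ⟨D, hD, hint⟩ := exists_forall_isInteger (monic_integralNormalization hne) hb1
  choose a ha using hint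
  refine ⟨A, inferInstance, a, hdich a ?_, fun m hm => ?_, fun h => ?_⟩
  · have h1 : act q'.integralNormalization (Algebra.linearMap A E ∘ a) = 0 := by
      convert comp_act_eq_zero (LinearMap.lsmul A E D) hb1 using 2
      ext m; exact ha m
    rw [act_comp] at h1
    ext m : 1
    exact hinj (by simpa using congrFun h1 m)
  · refine hinj ?_
    rw [ha, hm]; simp
  · have := ha n
    rw [h, map_zero, eq_comm, Algebra.smul_def, Algebra.smul_def] at this
    have hz : ∀ x : A, x ≠ 0 → algebraMap A E x ≠ 0 := fun x hx => by
      rwa [Ne, map_eq_zero_iff _ hinj]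
    simp only [mul_eq_zero, hz _ hD, hz _ (pow_ne_zero n hlc), hℓ, or_self] at this

theorem ZeroDichotomy.isVirtuallyPeriodic {V : Type*} [Zero V] {r : ℕ} (hr : 0 < r) {b : ℕ → V}
    (h : ZeroDichotomy r b) : IsVirtuallyPeriodic fun n => b n = 0 := by
  have key : ∀ c, ∃ N, ∀ n ≥ N, (b (c + r * (n + 1)) = 0 ↔ b (c + r * n) = 0) := by
    intro c
    by_cases hc : {n | b (c + r * n) = 0}.Infinite
    · exact ⟨0, fun n _ => by simp [h c hc]⟩
    · obtain ⟨M, hM⟩ := (Set.not_infinite.mp hc).bddAbove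
      refine ⟨M + 1, fun n hn => iff_of_false (fun h0 => ?_) fun h0 => ?_⟩
      · have := hM h0; omega
      · have := hM h0; omega
  choose N hN using key
  refine ⟨r * ((Finset.range r).sup N + 1), r, hr, fun n hn => propext ?_⟩
  have hmod := Nat.mod_lt n hr
  have hle : N (n % r) ≤ n / r := by
    have h1 : N (n % r) ≤ (Finset.range r).sup N := Finset.le_sup (Finset.mem_range.mpr hmod)
    have h2 : (Finset.range r).sup N + 1 ≤ n / r := by
      rw [Nat.le_div_iff_mul_le hr, mul_comm]; exact hn.le
    omega
  have := hN (n % r) (n / r) hle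
  rwa [Nat.mul_add, mul_one, ← add_assoc, Nat.mod_add_div] at this

theorem IsVirtuallyPeriodic.of_add {α : Type*} {a : ℕ → α} (m : ℕ)
    (h : IsVirtuallyPeriodic fun n => a (n + m)) : IsVirtuallyPeriodic a := by
  obtain ⟨N, r, hr, h⟩ := h
  refine ⟨N + m, r, hr, fun n hn => ?_⟩
  have := h (n - m) (by omega)
  dsimp only at this
  rwa [show n - m + r + m = n + r by omega, show n - m + m = n by omega] at this

/-- The Skolem–Mahler–Lech theorem: the set of zeros of a linear recurrence sequence over a field
of characteristic zero is virtually periodic. -/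
theorem isVirtuallyPeriodic_zeros {K V : Type*} [Field K] [CharZero K] [AddCommGroup V]
    [Module K V] {q : K[X]} (hq : q ≠ 0) {b : ℕ → V} (hb : act q b = 0) :
    IsVirtuallyPeriodic fun n => b n = 0 := by
  obtain ⟨s, hs⟩ := exists_isTranscendenceBasis ℤ K
  let A := MvPolynomial s ℤ
  let φ : A →ₐ[ℤ] K := MvPolynomial.aeval Subtype.val
  let _ : Algebra A K := φ.toAlgebra
  have hinj : Function.Injective (algebraMap A K) := hs.1
  have : FaithfulSMul A K := (faithfulSMul_iff_algebraMap_injective A K).mpr hinj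
  have : Algebra.IsAlgebraic A K := by
    have := hs.isAlgebraic
    exact Algebra.IsAlgebraic.of_ringHom_of_comp_eq hs.1.aevalEquiv (RingHom.id K)
      hs.1.aevalEquiv.surjective Function.injective_id
      (RingHom.ext fun x => hs.1.algebraMap_aevalEquiv x)
  let E := FractionRing A
  let _ : Algebra E K := FractionRing.liftAlgebra A K
  have : IsScalarTower A E K := FractionRing.isScalarTower_liftAlgebra A K
  let _ : Module E V := Module.compHom V (algebraMap E K)
  let _ : Module A V := Module.compHom V (algebraMap A K)
  have : IsScalarTower A K V := ⟨fun x y v => by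
    change (x • y) • v = (algebraMap A K x) • (y • v)
    rw [Algebra.smul_def, mul_smul]⟩
  have : IsScalarTower A E V := ⟨fun x y v => by
    change algebraMap E K (x • y) • v = (algebraMap A K x) • (algebraMap E K y • v)
    rw [Algebra.smul_def, map_mul, mul_smul, ← IsScalarTower.algebraMap_apply]⟩
  obtain ⟨p, hp, hpb⟩ := exists_act_eq_zero_of_isAlgebraic (A := A) hq hb
  -- Removing the powers of `X` makes the constant coefficient nonzero, at the cost of dropping the
  -- first `m` terms.
  obtain ⟨p₀, hp₀, hndvd⟩ := exists_eq_pow_rootMultiplicity_mul_and_not_dvd p hp 0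
  rw [C_0, sub_zero] at hp₀ hndvd
  set m := p.rootMultiplicity 0
  refine IsVirtuallyPeriodic.of_add m ?_
  have h0 : act p₀ (fun n => b (n + m)) = 0 := by
    rw [hp₀, mul_comm, act_mul] at hpb
    convert hpb using 2
    ext n; rw [act_X_pow]
  obtain ⟨r, hr, hd⟩ := exists_zeroDichotomy_of_isFractionRing (E := E)
    (by rwa [X_dvd_iff] at hndvd) h0
  exact hd.isVirtuallyPeriodic hr

end SkolemMahlerLech

/-! ### Operations on virtually periodic sequences -/

section VirtuallyPeriodic

variable {α β ι : Type*}

theorem IsVirtuallyPeriodic.comp {a : ℕ → α} (h : IsVirtuallyPeriodic a) (g : α → β) :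
    IsVirtuallyPeriodic fun n => g (a n) := by
  obtain ⟨N, r, hr, h⟩ := h
  exact ⟨N, r, hr, fun n hn => congrArg g (h n hn)⟩

theorem IsVirtuallyPeriodic.pi [Fintype ι] {a : ι → ℕ → α} (h : ∀ i, IsVirtuallyPeriodic (a i)) :
    IsVirtuallyPeriodic fun n i => a i n := by
  choose N r hr h using h
  have hmul : ∀ i k n, N i < n → a i (n + r i * k) = a i n := by
    intro i k n hn
    induction k with
    | zero => simp
    | succ k ih => rw [Nat.mul_succ, ← add_assoc, h i _ (by omega), ih]
  refine ⟨Finset.univ.sup N, ∏ i, r i, Finset.prod_pos fun i _ => hr i, fun n hn => ?_⟩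
  ext i
  obtain ⟨k, hk⟩ := Finset.dvd_prod_of_mem r (Finset.mem_univ i)
  rw [hk]
  exact hmul i k n ((Finset.le_sup (Finset.mem_univ i)).trans_lt hn)

end VirtuallyPeriodic

/-! ### Closure properties of linear recurrences -/

section LinearRecurrence

variable {K V : Type*} [Field K] [AddCommGroup V] [Module K V]

/-- The sequence `b` satisfies a linear recurrence with constant coefficients in `K`. -/
def IsLinRec (K : Type*) {V : Type*} [Field K] [AddCommGroup V] [Module K V] (b : ℕ → V) : Prop :=
  ∃ q : K[X], q ≠ 0 ∧ act q b = 0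

/-- This form makes closure under products immediate: the product of two finite-dimensional
shift-stable spaces is another, the shift being multiplicative. -/
theorem isLinRec_iff_exists_submodule {b : ℕ → V} :
    IsLinRec K b ↔ ∃ W : Submodule K (ℕ → V), Module.Finite K W ∧ b ∈ W ∧
      ∀ f ∈ W, shift K V f ∈ W := by
  let Φ : K[X] →ₗ[K] (ℕ → V) := LinearMap.applyₗ b ∘ₗ (aeval (shift K V)).toLinearMap
  have hΦ : ∀ p, Φ p = act p b := fun p => rfl
  constructor
  · rintro ⟨q, hq, hb⟩
    refine ⟨LinearMap.range Φ, ?_, ⟨1, by simp [Φ]⟩, ?_⟩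
    · have hmap : LinearMap.range Φ = (degreeLT K q.natDegree).map Φ := by
        refine le_antisymm ?_ LinearMap.map_le_range
        rintro _ ⟨p, rfl⟩
        refine ⟨p % q, ?_, ?_⟩
        · rw [SetLike.mem_coe, mem_degreeLT, ← degree_eq_natDegree hq]
          exact EuclideanDomain.mod_lt p hq
        · conv_rhs => rw [← EuclideanDomain.mod_add_div p q]
          rw [map_add, hΦ (q * _), act_eq_zero_of_dvd (dvd_mul_right _ _) hb, add_zero]
      have : Module.Finite K (degreeLT K q.natDegree) :=
        Module.Finite.equiv (degreeLTEquiv K q.natDegree).symm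
      rw [hmap]
      infer_instance
    · rintro _ ⟨p, rfl⟩
      exact ⟨X * p, by simp [Φ]⟩
  · rintro ⟨W, hW, hb, hshift⟩
    have hmem : ∀ p, Φ p ∈ W := by
      intro p
      induction p using Polynomial.induction_on' with
      | add p q hp hq => rw [map_add]; exact W.add_mem hp hq
      | monomial n c =>
        have hpow : (shift K V ^ n) b ∈ W := by
          induction n with
          | zero => simpa
          | succ n ih => rw [pow_succ', Module.End.mul_apply]; exact hshift _ ih
        rw [hΦ, ← C_mul_X_pow_eq_monomial]
        simpa [act] using W.smul_mem c hpow
    -- `K[X]` is infinite-dimensional, so some nonzero polynomial annihilates `b`.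
    have hni : ¬ Function.Injective (Φ.codRestrict W hmem) := fun hinj =>
      Polynomial.not_finite (R := K) (Module.Finite.of_injective _ hinj)
    rw [← LinearMap.ker_eq_bot, Submodule.eq_bot_iff] at hni
    push Not at hni
    obtain ⟨q, hq, hq0⟩ := hni
    exact ⟨q, hq0, congrArg Subtype.val hq⟩

theorem IsLinRec.comp {W : Type*} [AddCommGroup W] [Module K W] (f : V →ₗ[K] W) {b : ℕ → V}
    (hb : IsLinRec K b) : IsLinRec K (f ∘ b) := by
  obtain ⟨q, hq, hb⟩ := hb
  exact ⟨q, hq, comp_act_eq_zero f hb⟩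

theorem IsLinRec.of_comp {W : Type*} [AddCommGroup W] [Module K W] {f : V →ₗ[K] W}
    (hf : Function.Injective f) {b : ℕ → V} (hb : IsLinRec K (f ∘ b)) : IsLinRec K b := by
  obtain ⟨q, hq, hb⟩ := hb
  refine ⟨q, hq, ?_⟩
  rw [act_comp] at hb
  ext n : 1
  exact hf (by simpa using congrFun hb n)

theorem IsVirtuallyPeriodic.isLinRec {b : ℕ → V} (hb : IsVirtuallyPeriodic b) : IsLinRec K b := by
  obtain ⟨N, r, hr, h⟩ := hb
  refine ⟨X ^ (N + 1) * (X ^ r - 1), mul_ne_zero (pow_ne_zero _ X_ne_zero)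
    (monic_X_pow_sub_C 1 hr.ne').ne_zero, ?_⟩
  ext n
  have := h (n + (N + 1)) (by omega)
  rw [act_mul, act_X_pow]
  simp [act, this]

theorem isLinRec_const (v : V) : IsLinRec K fun _ => v :=
  IsVirtuallyPeriodic.isLinRec ⟨0, 1, one_pos, fun _ _ => rfl⟩

theorem IsLinRec.add {b c : ℕ → V} (hb : IsLinRec K b) (hc : IsLinRec K c) :
    IsLinRec K (b + c) := by
  obtain ⟨q, hq, hb⟩ := hb
  obtain ⟨p, hp, hc⟩ := hc
  refine ⟨q * p, mul_ne_zero hq hp, ?_⟩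
  rw [map_add, act_eq_zero_of_dvd (dvd_mul_right _ _) hb,
    act_eq_zero_of_dvd (dvd_mul_left _ _) hc, add_zero]

theorem IsLinRec.mul {B : Type*} [CommRing B] [Algebra K B] {b c : ℕ → B} (hb : IsLinRec K b)
    (hc : IsLinRec K c) : IsLinRec K (b * c) := by
  rw [isLinRec_iff_exists_submodule] at *
  obtain ⟨U, hU, hbU, hUs⟩ := hb
  obtain ⟨W, hW, hcW, hWs⟩ := hc
  refine ⟨U * W, ?_, Submodule.mul_mem_mul hbU hcW, fun f hf => ?_⟩
  · rw [Module.Finite.iff_fg] at *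
    exact hU.mul hW
  · induction hf using Submodule.mul_induction_on' with
    | mem_mul_mem u hu w hw => exact Submodule.mul_mem_mul (hUs u hu) (hWs w hw)
    | add x _ y _ hx hy => rw [map_add]; exact Submodule.add_mem _ hx hy

theorem IsLinRec.finsetSum {ι : Type*} (s : Finset ι) {b : ι → ℕ → V}
    (hb : ∀ i ∈ s, IsLinRec K (b i)) : IsLinRec K (∑ i ∈ s, b i) :=
  Finset.sum_induction _ (IsLinRec K) (fun _ _ => IsLinRec.add) (isLinRec_const 0) hb

theorem IsLinRec.finsetProd {ι B : Type*} [CommRing B] [Algebra K B] (s : Finset ι)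
    {b : ι → ℕ → B} (hb : ∀ i ∈ s, IsLinRec K (b i)) : IsLinRec K (∏ i ∈ s, b i) :=
  Finset.prod_induction _ (IsLinRec K) (fun _ _ => IsLinRec.mul) (isLinRec_const 1) hb

/-- A sequence in `F` with a linear recurrence over `K` is rational, with poles algebraic
over `K`. -/
theorem IsLinRec.exists_isGenFun {F : Type*} [Field F] [Algebra K F] {b : ℕ → F}
    (hb : IsLinRec K b) (E : Type*) [Field E] [Algebra F E] [Algebra K E] [IsScalarTower K F E] :
    ∃ R : RatFunc F, IsGenFun b R ∧ ∀ z : E, IsPole R z → IsAlgebraic K z := by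
  obtain ⟨q, hq, hb⟩ := hb
  obtain ⟨R, hR, hdvd⟩ := exists_isGenFun_of_act_eq_zero (q := q.map (algebraMap K F))
    (by simpa using hq) (by rwa [act_map_algebraMap])
  refine ⟨R, hR, fun z hz => ⟨q.reverse, by simpa using hq, ?_⟩⟩
  obtain ⟨g, hg⟩ := hdvd
  rw [reverse, natDegree_map, reflect_map, ← reverse] at hg
  rw [← aeval_map_algebraMap F, hg, map_mul, hz, zero_mul]

end LinearRecurrence

/-! ### Minimal polynomials as products over distinct conjugates -/

section Conjugates

/-- Representatives for the kernel of a map on a finite type, depending only on the kernel. -/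
theorem exists_kernel_representatives (ι β : Type*) [Fintype ι] [DecidableEq β] :
    ∃ rep : (ι → ι → Prop) → Finset ι, ∀ g : ι → β,
      Set.InjOn g (rep fun i j => g i = g j) ∧
        (rep fun i j => g i = g j).image g = Finset.univ.image g := by
  classical
  have key : ∀ R : ι → ι → Prop, ∃ S : Finset ι, ∀ g : ι → β, (R = fun i j => g i = g j) →
      Set.InjOn g S ∧ S.image g = Finset.univ.image g := by
    intro R
    by_cases hR : ∃ g : ι → β, R = fun i j => g i = g j
    · obtain ⟨g, rfl⟩ := hR
      obtain ⟨S, -, hS, hSg⟩ :=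
        (Set.surjOn_image g Set.univ).exists_subset_injOn_image_eq
      refine ⟨S.toFinset, fun g' h => ?_⟩
      have h' : ∀ i j, g i = g j ↔ g' i = g' j := fun i j => by
        rw [show (g i = g j) = (g' i = g' j) from congrFun (congrFun h i) j]
      refine ⟨fun i hi j hj hij => hS (by simpa using hi) (by simpa using hj) ((h' i j).mpr hij),
        (Finset.image_subset_image (Finset.subset_univ _)).antisymm fun y hy => ?_⟩
      obtain ⟨i, -, rfl⟩ := Finset.mem_image.mp hy
      obtain ⟨j, hj, hji⟩ : g i ∈ g '' S := hSg ▸ ⟨i, trivial, rfl⟩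
      exact Finset.mem_image.mpr ⟨j, by simpa using hj, (h' j i).mp hji⟩
    · exact ⟨∅, fun g hg => (hR ⟨g, hg⟩).elim⟩
  choose rep hrep using key
  exact ⟨rep, fun g => hrep _ g rfl⟩

theorem map_minpoly_eq_prod_image {K L M : Type*} [Field K] [CharZero K] [Field L] [Algebra K L]
    [FiniteDimensional K L] [Field M] [Algebra K M] [IsAlgClosed M] [DecidableEq M] (x : L) :
    (minpoly K x).map (algebraMap K M) =
      ∏ y ∈ Finset.univ.image (fun σ : L →ₐ[K] M => σ x), (X - C y) := by
  have hint : IsIntegral K x := Algebra.IsIntegral.isIntegral x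
  have hsplit := IsAlgClosed.splits ((minpoly K x).map (algebraMap K M))
  have hmonic : ((minpoly K x).map (algebraMap K M)).Monic := (minpoly.monic hint).map _
  have hnodup : ((minpoly K x).aroots M).Nodup :=
    nodup_roots ((minpoly.irreducible hint).separable.map)
  have himage : Finset.univ.image (fun σ : L →ₐ[K] M => σ x) =
      ((minpoly K x).aroots M).toFinset := by
    rw [← Finset.coe_inj, Finset.coe_image, Finset.coe_univ, Set.image_univ,
      Algebra.IsAlgebraic.range_eval_eq_rootSet_minpoly, rootSet_def]
  rw [himage]
  conv_lhs => rw [hsplit.eq_prod_roots_of_monic hmonic]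
  rw [Finset.prod, Multiset.toFinset_val, hnodup.dedup]

end Conjugates

/-! ### The main theorem -/

theorem theorem3 {K L : Type*} [Field K] [CharZero K] [Field L] [Algebra K L]
    [FiniteDimensional K L] (a : ℕ → L) (ha : IsRationalSeq a) :
    IsVirtuallyPeriodic (fun n => Module.finrank K K⟮a n⟯) ∧
    ∃ R : RatFunc (RatFunc K),
      IsGenFun (fun n => minpolyT K (a n)) R ∧
      ∀ z : AlgebraicClosure (RatFunc K), IsPole R z → IsAlgebraic K z := by
  classical
  obtain ⟨q, hq, hqa⟩ := ha.exists_act_eq_zero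
  obtain ⟨p, hp, hpa⟩ := exists_act_eq_zero_of_isAlgebraic (A := K) hq hqa
  let M := AlgebraicClosure K
  let H := L →ₐ[K] M
  let e : ℕ → H → H → Prop := fun n σ τ => σ (a n) = τ (a n)
  have he : IsVirtuallyPeriodic e := by
    have hpair : ∀ i : H × H, IsVirtuallyPeriodic fun n => i.1 (a n) = i.2 (a n) := by
      intro i
      have := isVirtuallyPeriodic_zeros hp
        (comp_act_eq_zero (i.1.toLinearMap - i.2.toLinearMap) hpa)
      simpa [sub_eq_zero] using this
    exact (IsVirtuallyPeriodic.pi hpair).comp fun (f : H × H → Prop) σ τ => f (σ, τ)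
  -- The representatives depend on `n` only through the pattern `e n`, so they inherit its
  -- periodicity.
  obtain ⟨rep, hrep⟩ := exists_kernel_representatives H M
  have hmin : ∀ n, (minpoly K (a n)).map (algebraMap K M) =
      ∏ σ ∈ rep (e n), (X - C (σ (a n))) := by
    intro n
    obtain ⟨h1, h2⟩ := hrep fun σ => σ (a n)
    rw [map_minpoly_eq_prod_image, ← h2, Finset.prod_image h1]
  constructor
  · have hdeg : ∀ n, Module.finrank K K⟮a n⟯ = (rep (e n)).card := by
      intro n
      rw [IntermediateField.adjoin.finrank (Algebra.IsIntegral.isIntegral (a n)),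
        ← natDegree_map (algebraMap K M), hmin, natDegree_finsetProd_X_sub_C_eq_card]
    simp_rw [hdeg]
    exact he.comp fun E => (rep E).card
  · have hconj : ∀ σ : H, IsLinRec K fun n => (X - C (σ (a n)) : M[X]) := by
      intro σ
      let f : L →ₗ[K] M[X] := -((CAlgHom (R := K) (A := M)).comp σ).toLinearMap
      have h := (isLinRec_const (K := K) (X : M[X])).add (IsLinRec.comp f ⟨p, hp, hpa⟩)
      convert h using 2 with n
      simp [f, sub_eq_add_neg]
    -- There are finitely many patterns `E`; the indicator of `e n = E` selects the product over the
    -- representatives valid at `n`.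
    have hsum : (Polynomial.mapAlgHom (Algebra.ofId K M)).toLinearMap ∘
        (fun n => minpoly K (a n)) =
        ∑ E : H → H → Prop, (fun n => if e n = E then (1 : M[X]) else 0) *
          ∏ σ ∈ rep E, fun n => (X - C (σ (a n)) : M[X]) := by
      ext1 n
      rw [Finset.sum_apply, Finset.sum_eq_single (e n)]
      · simpa using hmin n
      · intro E _ hE
        simp [hE.symm]
      · simp
    have hlin : IsLinRec K fun n => minpoly K (a n) := by
      refine IsLinRec.of_comp (f := (Polynomial.mapAlgHom (Algebra.ofId K M)).toLinearMap)
        (Polynomial.map_injective _ (algebraMap K M).injective) ?_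
      rw [hsum]
      exact IsLinRec.finsetSum _ fun E _ =>
        (he.comp fun E' => if E' = E then (1 : M[X]) else 0).isLinRec.mul
          (IsLinRec.finsetProd _ fun σ _ => hconj σ)
    exact IsLinRec.exists_isGenFun
      (hlin.comp (IsScalarTower.toAlgHom K K[X] (RatFunc K)).toLinearMap) _
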